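/- Let $(\Omega,\mathcal F)$ be a measurable space. A set function $\mu:\mathcal F\to[0,1]$ is a capacity if $\mu(\emptyset)=0$, $\mu(\Omega)=1$ and $\mu(A)\le\mu(B)$ whenever $A\subset B$ in $\mathcal F$. A statement holds $\mu$-a.s. if it holds on some $A\in\mathcal F$ with $\mu(A^c)=0$. The core of $\mu$, $\operatorname{core}(\mu)$, is the set of all additive capacities $P$ on $\mathcal F$ with $P(A)\le\mu(A)$ for all $A\in\mathcal F$. A capacity $V$ is an upper probability if there is a set $\Lambda$ of (countably additive) probabilities on $\mathcal F$, compact in the topology of setwise convergence on $\mathcal F$, with $V(A)=\max_{P\in\Lambda}P(A)$ for all $A\in\mathcal F$; then every element of $\operatorname{core}(V)$ is a probability. A capacity preserving system $(\Omega,\mathcal F,\mu,T)$ consists of a measurable space $(\Omega,\mathcal F)$, a capacity $\mu$ on $\mathcal F$ and a measurable map $T:\Omega\to\Omega$ with $\mu(T^{-1}A)=\mu(A)$ for all $A\in\mathcal F$. A capacity $\mu$ is called ergodic with respect to a measurable map $T$ if every $B\in\mathcal F$ with $T^{-1}B=B$ satisfies both ($\mu(B)=0$ or $\mu(B)=1$)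 and ($\mu(B)=0$ or $\mu(B^c)=0$). It is called weakly mixing with respect to $T$ if every measurable $f:\Omega\to\mathbb C$ such that $f\circ T=\lambda f$ $\mu$-a.s. for some $\lambda\in\mathbb C$ is constant $\mu$-a.s. For upper probabilities $V_1,V_2$ on $(\Omega_1,\mathcal F_1)$ and $(\Omega_2,\mathcal F_2)$, the product $V_1\times V_2$ is defined on the product $\sigma$-algebra $\mathcal F_1\otimes\mathcal F_2$ by $$(V_1\times V_2)(A)=\max_{P_1\in\operatorname{core}(V_1),\,P_2\in\operatorname{core}(V_2)}(P_1\times P_2)(A).$$ For maps $T_1,T_2$ put $(T_1\times T_2)(\omega_1,\omega_2)=(T_1\omega_1,T_2\omega_2)$. **Theorem.** Let $(\Omega,\mathcal F,V,T)$ be a capacity preserving system, where $V$ is an upper probability. Then the following statements are equivalent: 1. $V$ is weakly mixing with respect to $T$; 2. for every capacity preserving system $(\Omega',\mathcal F',V',T')$ such that $V'$ is an upper probability that is ergodic with respect to $T'$, the product $V\times V'$ is ergodic with respect to $T\times T'$; 3. $V\times V$ is ergodic with respect to $T\times T$. -/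

import Mathlib

universe u

namespace CapacitySystem

open MeasureTheory

/-- A set function is represented by a map `Set Ω → ℝ`; only its values on measurable sets are
ever used. A capacity is normalized and monotone (so its values on measurable sets lie in
`[0, 1]`). -/
structure IsCapacity {Ω : Type*} [MeasurableSpace Ω] (μ : Set Ω → ℝ) : Prop where
  empty : μ ∅ = 0
  univ : μ Set.univ = 1
  mono : ∀ A B : Set Ω, MeasurableSet A → MeasurableSet B → A ⊆ B → μ A ≤ μ B

/-- Finite additivity on measurable sets. -/
def IsAdditive {Ω : Type*} [MeasurableSpace Ω] (μ : Set Ω → ℝ) : Prop :=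
  ∀ A B : Set Ω, MeasurableSet A → MeasurableSet B → Disjoint A B → μ (A ∪ B) = μ A + μ B

/-- The real-valued set function `A ↦ P(A)` of a probability measure. -/
noncomputable def toSetFun {Ω : Type*} [MeasurableSpace Ω] (P : ProbabilityMeasure Ω) :
    Set Ω → ℝ :=
  fun A => (P : Measure Ω).real A

/-- The weak* topology on the (countably additive) probability measures: the coarsest topology
for which `P ↦ P(A)` is continuous for every measurable `A`. -/
@[reducible] noncomputable def weakStarTopology (Ω : Type*) [MeasurableSpace Ω] :
    TopologicalSpace (ProbabilityMeasure Ω) :=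
  TopologicalSpace.induced
    (fun P => fun A : {A : Set Ω // MeasurableSet A} => toSetFun P A.1) inferInstance

/-- An upper probability: a capacity of the form `V(A) = max_{P ∈ Λ} P(A)`, where `Λ` is a weak*
compact set of probability measures. -/
def IsUpperProbability {Ω : Type*} [MeasurableSpace Ω] (V : Set Ω → ℝ) : Prop :=
  IsCapacity V ∧
    ∃ Λ : Set (ProbabilityMeasure Ω),
      @IsCompact (ProbabilityMeasure Ω) (weakStarTopology Ω) Λ ∧
      ∀ A : Set Ω, MeasurableSet A → IsGreatest ((fun P => toSetFun P A) '' Λ) (V A)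

/-- The core: all additive capacities dominated by `μ` on the measurable sets. -/
def core {Ω : Type*} [MeasurableSpace Ω] (μ : Set Ω → ℝ) : Set (Set Ω → ℝ) :=
  {P | IsCapacity P ∧ IsAdditive P ∧ ∀ A : Set Ω, MeasurableSet A → P A ≤ μ A}

/-- The product of two upper probabilities,
`(V₁ × V₂)(A) = max {(P₁ × P₂)(A) : P₁ ∈ core V₁, P₂ ∈ core V₂}`.
Every element of the core of an upper probability is countably additive, so nothing of the core is
lost by letting `P₁` and `P₂` range over probability measures, for which the product is defined.
For upper probabilities and measurable `A` the set below is nonempty and contained in `[0, 1]`, and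
its supremum is attained. -/
noncomputable def prod {Ω₁ Ω₂ : Type*} [MeasurableSpace Ω₁] [MeasurableSpace Ω₂]
    (V₁ : Set Ω₁ → ℝ) (V₂ : Set Ω₂ → ℝ) : Set (Ω₁ × Ω₂) → ℝ :=
  fun A => sSup {r : ℝ | ∃ (P₁ : ProbabilityMeasure Ω₁) (P₂ : ProbabilityMeasure Ω₂),
    toSetFun P₁ ∈ core V₁ ∧ toSetFun P₂ ∈ core V₂ ∧
      r = ((P₁ : Measure Ω₁).prod (P₂ : Measure Ω₂)).real A}

/-- `(Ω, 𝓕, μ, T)` is a capacity preserving system. -/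
structure IsCapacityPreserving {Ω : Type*} [MeasurableSpace Ω] (μ : Set Ω → ℝ) (T : Ω → Ω) :
    Prop where
  isCapacity : IsCapacity μ
  measurable : Measurable T
  invariant : ∀ A : Set Ω, MeasurableSet A → μ (T ⁻¹' A) = μ A

/-- Ergodicity of a capacity with respect to `T`: both conditions are imposed on every measurable
set `B` with `T⁻¹ B = B`. -/
def IsErgodic {Ω : Type*} [MeasurableSpace Ω] (μ : Set Ω → ℝ) (T : Ω → Ω) : Prop :=
  ∀ B : Set Ω, MeasurableSet B → T ⁻¹' B = B →
    (μ B = 0 ∨ μ B = 1) ∧ (μ B = 0 ∨ μ Bᶜ = 0)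

/-- A statement holds `μ`-a.s. if it holds on a measurable set whose complement has capacity
zero. -/
def AlmostSurely {Ω : Type*} [MeasurableSpace Ω] (μ : Set Ω → ℝ) (p : Ω → Prop) : Prop :=
  ∃ A : Set Ω, MeasurableSet A ∧ μ Aᶜ = 0 ∧ ∀ ω ∈ A, p ω

/-- Weak mixing: every measurable complex eigenfunction is almost surely constant. -/
def IsWeaklyMixing {Ω : Type*} [MeasurableSpace Ω] (μ : Set Ω → ℝ) (T : Ω → Ω) : Prop :=
  ∀ f : Ω → ℂ, Measurable f →
    (∃ l : ℂ, AlmostSurely μ (fun ω => f (T ω) = l * f ω)) →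
    ∃ c : ℂ, AlmostSurely μ (fun ω => f ω = c)

end CapacitySystem

/-! An upper probability need not be additive, but the relevant notions depend essentially on its
null sets. If each strictly invariant set or its complement is `V`-null, a single invariant
probability `Q` in the core has the same null sets as `V`, and `Q` is ergodic
(`IsUpperProbability.exists_ergodic_isControlMeasure`). It arises as a limit of Cesàro averages of a
core element; compactness of the representing set makes the limit countably additive and forces
`Q`-null sets to be `V`-null. "Almost surely" then means the same for `V` and `Q`, and the product
of two controlled upper probabilities has the null sets of the product of the controls
(`prod_eq_zero_iff`). What remains is the classical theorem for measures.

The classical core is `ergodic_prodMap`. An invariant set `B` of the product yields an operator `Ψ`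
with kernel `1_B - c` which intertwines the Koopman operators, where `c` is the almost sure measure
of the sections of `B`. If the compact operator `Ψ Ψ*` were nonzero, it would have a
finite-dimensional eigenspace stable under the Koopman operator, hence would produce an
eigenfunction. That function is constant, while `Ψ*` kills constants: a contradiction. So `Ψ* = 0`,
and restriction to `B` only scales the product measure by `c`, which makes `B` trivial. Conversely,
an eigenfunction `f` gives the invariant function `f y / f x` on the square, and ergodicity makes
`f` constant. -/

namespace CapacitySystem
open MeasureTheory Filter Set
open scoped ENNReal

/-! ### Common eigenvectors of commuting operators -/

section Hilbert

variable {H : Type*} [NormedAddCommGroup H] [InnerProductSpace ℂ H] [CompleteSpace H]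

/-- A nonzero compact symmetric operator shares an eigenvector for a nonzero eigenvalue with every
operator commuting with it. -/
theorem exists_common_eigenvector {K U : H →L[ℂ] H} (hK : IsCompactOperator K)
    (hsymm : K.IsSymmetric) (hne : K ≠ 0) (hcomm : ∀ v, K (U v) = U (K v)) :
    ∃ v : H, v ≠ 0 ∧ (∃ κ : ℂ, κ ≠ 0 ∧ K v = κ • v) ∧ ∃ l : ℂ, U v = l • v := by
  obtain ⟨κ, hκ, hκ0⟩ : ∃ κ, Module.End.HasEigenvalue (K : Module.End ℂ H) κ ∧ κ ≠ 0 := by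
    by_contra! h
    exact hne ((K.eq_zero_of_forall_hasEigenvalue_eq_zero hK hsymm).1 h)
  set E := Module.End.eigenspace (K : Module.End ℂ H) κ with hE
  have hmem : ∀ v, v ∈ E ↔ K v = κ • v := fun v => Module.End.mem_eigenspace_iff
  have hEK : ∀ v ∈ E, (K : H →ₗ[ℂ] H) v ∈ E := fun v hv => by
    have := (hmem v).1 hv
    rw [ContinuousLinearMap.coe_coe, this]
    exact E.smul_mem _ hv
  have hEU : ∀ v ∈ E, (U : H →ₗ[ℂ] H) v ∈ E := fun v hv => by
    rw [ContinuousLinearMap.coe_coe, hmem, hcomm, (hmem v).1 hv, map_smul]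
  have hclosed : IsClosed (E : Set H) := by
    have : (E : Set H) = {v | K v = κ • v} := Set.ext hmem
    rw [this]
    exact isClosed_eq K.continuous (continuous_const_smul κ)
  have hcpt : IsCompactOperator ((K : H →ₗ[ℂ] H).restrict hEK) := hK.restrict hEK hclosed
  -- `K` acts on `E` as the nonzero scalar `κ`, so compactness of `K` makes the identity of `E`
  -- compact.
  have hfin : FiniteDimensional ℂ E := by
    refine FiniteDimensional.of_isCompactOperator_id (𝕜 := ℂ) ?_
    have hid : (id : E → E) = κ⁻¹ • ⇑((K : H →ₗ[ℂ] H).restrict hEK) := by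
      funext v
      refine Subtype.ext ?_
      simp [(hmem v.1).1 v.2, smul_smul, hκ0]
    rw [hid]
    exact hcpt.smul κ⁻¹
  have hnt : Nontrivial E := (Submodule.nontrivial_iff_ne_bot).2 hκ
  obtain ⟨l, hl⟩ := Module.End.exists_eigenvalue ((U : H →ₗ[ℂ] H).restrict hEU)
  obtain ⟨v, hv⟩ := hl.exists_hasEigenvector
  refine ⟨v, fun h => hv.2 (Subtype.ext h), ⟨κ, hκ0, (hmem v).1 v.2⟩, l, ?_⟩
  simpa using congrArg Subtype.val hv.apply_eq_smul

end Hilbert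

/-! ### Compact integral operators with indicator kernels -/

section SectionOperator

variable {α β : Type*} [MeasurableSpace α] [MeasurableSpace β]

theorem norm_sq_L2 {μ : Measure α} (f : Lp ℂ 2 μ) : ‖f‖ ^ 2 = ∫ x, ‖f x‖ ^ 2 ∂μ := by
  have h := inner_self_eq_norm_sq_to_K (𝕜 := ℂ) f
  rw [L2.inner_def] at h
  have h2 : ∀ x, inner ℂ (f x) (f x) = ((‖f x‖ ^ 2 : ℝ) : ℂ) := fun x => by
    rw [inner_self_eq_norm_sq_to_K]; simp
  simp_rw [h2] at h
  have h3 : ((∫ x, ‖f x‖ ^ 2 ∂μ : ℝ) : ℂ) = ((‖f‖ ^ 2 : ℝ) : ℂ) := by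
    rw [← integral_complex_ofReal, h]
    simp
  exact (Complex.ofReal_injective h3).symm

/-- The integral of `g` over the section of `B` at `x`. -/
noncomputable def sectionIntegral (ν : Measure β) (B : Set (α × β)) (g : β → ℂ) (x : α) : ℂ :=
  ∫ y in Prod.mk x ⁻¹' B, g y ∂ν

theorem sectionIntegral_eq_indicator {ν : Measure β} {B : Set (α × β)} (hB : MeasurableSet B) (g : β → ℂ) (x : α) :
    sectionIntegral ν B g x = ∫ y, B.indicator (fun p => g p.2) (x, y) ∂ν := by
  rw [sectionIntegral, ← integral_indicator (measurable_prodMk_left hB)]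
  rfl

theorem sectionIntegral_congr {α : Type*} {ν : Measure β} {B : Set (α × β)} {g g' : β → ℂ} (h : g =ᵐ[ν] g') :
    sectionIntegral ν B g = sectionIntegral ν B g' := by
  funext x
  exact integral_congr_ae (ae_restrict_of_ae h)

variable {μ : Measure α} {ν : Measure β} [IsProbabilityMeasure μ] [IsProbabilityMeasure ν]

/-- Cauchy–Schwarz for `g` against the indicator of the section. -/
theorem norm_sectionIntegral_sq_le {B : Set (α × β)} (hB : MeasurableSet B) (g : Lp ℂ 2 ν) (x : α) :
    ‖sectionIntegral ν B g x‖ ^ 2 ≤ ν.real (Prod.mk x ⁻¹' B) * ‖g‖ ^ 2 := by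
  have hs : MeasurableSet (Prod.mk x ⁻¹' B) := measurable_prodMk_left hB
  have := norm_inner_le_norm (𝕜 := ℂ)
    (indicatorConstLp 2 hs (measure_ne_top ν _) (1 : ℂ)) g
  rw [L2.inner_indicatorConstLp_one, norm_indicatorConstLp (by simp) (by simp)] at this
  calc ‖sectionIntegral ν B g x‖ ^ 2
      ≤ (‖(1 : ℂ)‖ * ν.real (Prod.mk x ⁻¹' B) ^ (1 / (2 : ℝ≥0∞).toReal) * ‖g‖) ^ 2 := by
        gcongr; exact this
    _ = _ := by
        rw [mul_pow, norm_one, one_mul, ← Real.rpow_natCast, ← Real.rpow_mul measureReal_nonneg]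
        simp

theorem stronglyMeasurable_sectionIntegral {B : Set (α × β)} (hB : MeasurableSet B) (g : Lp ℂ 2 ν) :
    StronglyMeasurable (sectionIntegral (α := α) ν B g) := by
  have : sectionIntegral (α := α) ν B g
      = fun x => ∫ y, B.indicator (fun p => g p.2) (x, y) ∂ν :=
    funext (sectionIntegral_eq_indicator hB g)
  rw [this]
  refine StronglyMeasurable.integral_prod_right' (f := B.indicator (fun p : α × β => g p.2)) ?_
  exact ((Lp.stronglyMeasurable g).comp_measurable measurable_snd).indicator hB

theorem memLp_sectionIntegral {B : Set (α × β)} (hB : MeasurableSet B) (g : Lp ℂ 2 ν) :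
    MemLp (sectionIntegral ν B g) 2 μ := by
  refine MemLp.of_bound (stronglyMeasurable_sectionIntegral hB g).aestronglyMeasurable ‖g‖ ?_
  refine Eventually.of_forall fun x => ?_
  refine (sq_le_sq₀ (norm_nonneg _) (norm_nonneg _)).1 ?_
  refine (norm_sectionIntegral_sq_le hB g x).trans ?_
  exact mul_le_of_le_one_left (by positivity) measureReal_le_one

variable (μ ν) in
/-- Integration over the sections of `B`, as an operator from `L²(ν)` to `L²(μ)`. -/
noncomputable def sectionOp (B : Set (α × β)) (hB : MeasurableSet B) : Lp ℂ 2 ν →L[ℂ] Lp ℂ 2 μ :=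
  LinearMap.mkContinuous
    { toFun := fun g => (memLp_sectionIntegral hB g).toLp
      map_add' := fun g g' => by
        rw [← MemLp.toLp_add]
        congr 1
        funext x
        rw [sectionIntegral_congr (Lp.coeFn_add g g'), Pi.add_apply]
        exact integral_add (((Lp.memLp g).integrable (by norm_num)).restrict)
          (((Lp.memLp g').integrable (by norm_num)).restrict)
      map_smul' := fun c g => by
        rw [RingHom.id_apply, ← MemLp.toLp_const_smul]
        congr 1
        funext x
        rw [sectionIntegral_congr (Lp.coeFn_smul c g), Pi.smul_apply]
        exact integral_smul c _ }
    √((μ.prod ν).real B) fun g => by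
      refine (sq_le_sq₀ (norm_nonneg _) (by positivity)).1 ?_
      rw [mul_pow, Real.sq_sqrt measureReal_nonneg, norm_sq_L2]
      have h1 : ∫ x, ‖((memLp_sectionIntegral (μ := μ) hB g).toLp) x‖ ^ 2 ∂μ
          ≤ ∫ x, ν.real (Prod.mk x ⁻¹' B) * ‖g‖ ^ 2 ∂μ := by
        refine integral_mono_ae ?_ ?_ ?_
        · exact (Lp.memLp _).integrable_norm_pow (by norm_num)
        · refine Integrable.mul_const ?_ _
          exact Integrable.of_bound
            (measurable_measure_prodMk_left hB).ennreal_toReal.aestronglyMeasurable 1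
            (Eventually.of_forall fun x => by
              rw [Real.norm_of_nonneg measureReal_nonneg]; exact measureReal_le_one)
        · filter_upwards [(memLp_sectionIntegral (μ := μ) hB g).coeFn_toLp] with x hx
          rw [hx]
          exact norm_sectionIntegral_sq_le hB g x
      refine h1.trans (le_of_eq ?_)
      rw [integral_mul_const, measureReal_def, Measure.prod_apply hB]
      congr 1
      exact integral_toReal (measurable_measure_prodMk_left hB).aemeasurable
        (Eventually.of_forall fun x => measure_lt_top _ _)

/-- The bound is the Hilbert–Schmidt norm of the kernel `1_B`. It makes the operator small when `B`
has small measure, which gives norm convergence along countable unions. -/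
theorem norm_sectionOp_le {B : Set (α × β)} (hB : MeasurableSet B) :
    ‖sectionOp μ ν B hB‖ ≤ √((μ.prod ν).real B) :=
  LinearMap.mkContinuous_norm_le _ (by positivity) _

theorem coeFn_sectionOp {B : Set (α × β)} (hB : MeasurableSet B) (g : Lp ℂ 2 ν) :
    sectionOp μ ν B hB g =ᵐ[μ] sectionIntegral ν B g :=
  (memLp_sectionIntegral hB g).coeFn_toLp

theorem sectionOp_union {A B : Set (α × β)} (hA : MeasurableSet A) (hB : MeasurableSet B)
    (h : Disjoint A B) :
    sectionOp μ ν (A ∪ B) (hA.union hB) = sectionOp μ ν A hA + sectionOp μ ν B hB := by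
  ext g : 1
  refine Lp.ext ?_
  filter_upwards [coeFn_sectionOp (μ := μ) (hA.union hB) g, coeFn_sectionOp (μ := μ) hA g,
    coeFn_sectionOp (μ := μ) hB g,
    Lp.coeFn_add (sectionOp μ ν A hA g) (sectionOp μ ν B hB g)] with x h1 h2 h3 h4
  rw [_root_.add_apply, h4, Pi.add_apply, h1, h2, h3]
  have hi := (Lp.memLp g).integrable (μ := ν) (by norm_num)
  exact setIntegral_union (h.preimage _) (measurable_prodMk_left hB) hi.integrableOn hi.integrableOn

theorem isCompactOperator_sectionOp_prod {s : Set α} {t : Set β} (hs : MeasurableSet s)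
    (ht : MeasurableSet t) : IsCompactOperator (sectionOp μ ν (s ×ˢ t) (hs.prod ht)) := by
  have key : sectionOp μ ν (s ×ˢ t) (hs.prod ht) =
      (ContinuousLinearMap.toSpanSingleton ℂ (indicatorConstLp 2 hs (measure_ne_top μ s) (1 : ℂ))) ∘L
        (innerSL ℂ (indicatorConstLp 2 ht (measure_ne_top ν t) (1 : ℂ))) := by
    ext g : 1
    refine Lp.ext ?_
    rw [ContinuousLinearMap.comp_apply, innerSL_apply_apply, L2.inner_indicatorConstLp_one,
      ContinuousLinearMap.toSpanSingleton_apply]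
    filter_upwards [coeFn_sectionOp (μ := μ) (hs.prod ht) g,
      Lp.coeFn_smul (∫ y in t, g y ∂ν) (indicatorConstLp 2 hs (measure_ne_top μ s) (1 : ℂ)),
      indicatorConstLp_coeFn (p := 2) (hs := hs) (hμs := measure_ne_top μ s) (c := (1 : ℂ))]
      with x h1 h2 h3
    rw [h1, h2, Pi.smul_apply, h3, sectionIntegral]
    by_cases hx : x ∈ s
    · simp [hx]
    · simp [hx]
  rw [key]
  have h : IsCompactOperator (ContinuousLinearMap.toSpanSingleton ℂ
      (indicatorConstLp 2 hs (measure_ne_top μ s) (1 : ℂ))) :=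
    isCompactOperator_of_locallyCompactSpace_rng _
  exact h.comp_clm _

/-- Rectangles give operators of rank at most one, and the π-λ induction extends compactness to all
measurable sets: complements are differences from the full rectangle, and countable disjoint unions
are norm limits of finite ones because the measure of the tail tends to zero. -/
theorem isCompactOperator_sectionOp {B : Set (α × β)} (hB : MeasurableSet B) :
    IsCompactOperator (sectionOp μ ν B hB) := by
  induction B, hB using MeasurableSpace.induction_on_inter generateFrom_prod.symm isPiSystem_prod with
  | empty =>
    have h := norm_sectionOp_le (μ := μ) (ν := ν) (MeasurableSet.empty (α := α × β))
    have : sectionOp μ ν ∅ MeasurableSet.empty = 0 := by simpa using h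
    rw [this]
    exact isCompactOperator_zero
  | basic t ht =>
    obtain ⟨s, hs, u, hu, rfl⟩ := ht
    exact isCompactOperator_sectionOp_prod hs hu
  | compl t htm ih =>
    have h1 := sectionOp_union (μ := μ) (ν := ν) htm htm.compl disjoint_compl_right
    have h2 := isCompactOperator_sectionOp_prod (μ := μ) (ν := ν) MeasurableSet.univ
      MeasurableSet.univ
    simp only [univ_prod_univ, union_compl_self] at h1 h2
    rw [h1] at h2
    have h3 : (sectionOp μ ν tᶜ htm.compl : Lp ℂ 2 ν → Lp ℂ 2 μ)
        = ⇑(sectionOp μ ν t htm + sectionOp μ ν tᶜ htm.compl) - ⇑(sectionOp μ ν t htm) := by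
      funext g
      simp
    rw [h3]
    exact h2.sub ih
  | iUnion f hd hf ih =>
    have hmu : ∀ n, MeasurableSet (⋃ i ∈ Finset.range n, f i) := fun n =>
      Finset.measurableSet_biUnion _ fun i _ => hf i
    have hrest : ∀ n, MeasurableSet ((⋃ i, f i) \ ⋃ i ∈ Finset.range n, f i) := fun n =>
      (MeasurableSet.iUnion hf).diff (hmu n)
    have hfin : ∀ n, IsCompactOperator (sectionOp μ ν _ (hmu n)) := by
      intro n
      induction n with
      | zero =>
        have h := norm_sectionOp_le (μ := μ) (ν := ν) (hmu 0)
        have : sectionOp μ ν _ (hmu 0) = 0 := by simpa using h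
        rw [this]
        exact isCompactOperator_zero
      | succ n ihn =>
        have hdj : Disjoint (⋃ i ∈ Finset.range n, f i) (f n) := by
          simp only [Set.disjoint_iUnion_left, Finset.mem_range]
          exact fun i hi => hd hi.ne
        have h1 := sectionOp_union (μ := μ) (ν := ν) (hmu n) (hf n) hdj
        have h2 : (⋃ i ∈ Finset.range (n + 1), f i) = (⋃ i ∈ Finset.range n, f i) ∪ f n := by
          rw [Finset.range_add_one, Finset.set_biUnion_insert, union_comm]
        simp only [h2]
        rw [h1]
        exact ihn.add (ih n)
    refine isCompactOperator_of_tendsto (l := atTop)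
      (F := fun n => sectionOp μ ν _ (hmu n)) ?_ (Eventually.of_forall hfin)
    rw [tendsto_iff_norm_sub_tendsto_zero]
    have hlim : Tendsto (fun n => √((μ.prod ν).real ((⋃ i, f i) \ ⋃ i ∈ Finset.range n, f i)))
        atTop (nhds 0) := by
      rw [← Real.sqrt_zero]
      refine (Real.continuous_sqrt.tendsto _).comp ?_
      have h0 : (μ.prod ν).real (⋂ n, ((⋃ i, f i) \ ⋃ i ∈ Finset.range n, f i)) = 0 := by
        convert measureReal_empty (μ := μ.prod ν)
        ext p
        simp only [mem_iInter, Set.mem_sdiff, mem_iUnion, Finset.mem_range, mem_empty_iff_false,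
          iff_false, not_forall]
        by_cases hp : ∃ i, p ∈ f i
        · obtain ⟨i, hi⟩ := hp
          exact ⟨i + 1, fun h => h.2 ⟨i, by omega, hi⟩⟩
        · exact ⟨0, fun h => hp h.1⟩
      rw [← h0]
      refine (ENNReal.tendsto_toReal (measure_ne_top _ _)).comp
        (tendsto_measure_iInter_atTop (fun n => (hrest n).nullMeasurableSet) ?_
          ⟨0, measure_ne_top _ _⟩)
      intro m n hmn
      exact sdiff_subset_sdiff_right (biUnion_subset_biUnion_left fun i hi => by
        simp only [Finset.mem_range, SetLike.mem_coe] at hi ⊢; omega)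
    refine squeeze_zero (fun _ => norm_nonneg _) (fun n => ?_) hlim
    have hdj : Disjoint (⋃ i ∈ Finset.range n, f i) ((⋃ i, f i) \ ⋃ i ∈ Finset.range n, f i) :=
      disjoint_sdiff_right
    have h1 := sectionOp_union (μ := μ) (ν := ν) (hmu n) (hrest n) hdj
    have h2 : (⋃ i ∈ Finset.range n, f i) ∪ ((⋃ i, f i) \ ⋃ i ∈ Finset.range n, f i)
        = ⋃ i, f i := union_sdiff_cancel (iUnion₂_subset fun i _ => subset_iUnion f i)
    simp only [h2] at h1
    rw [h1, sub_add_cancel_left, norm_neg]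
    exact norm_sectionOp_le (hrest n)

end SectionOperator
end CapacitySystem
namespace CapacitySystem
open MeasureTheory Filter Set
open scoped ENNReal ComplexConjugate

/-! ### Centered operators and ergodicity of product measures -/

section SectionOperator

variable {α β : Type*} [MeasurableSpace α] [MeasurableSpace β]
variable {μ : Measure α} {ν : Measure β} [IsProbabilityMeasure μ] [IsProbabilityMeasure ν]

theorem inner_sectionOp_right {B : Set (α × β)} (hB : MeasurableSet B) (f : Lp ℂ 2 μ)
    (g : Lp ℂ 2 ν) : inner ℂ f (sectionOp μ ν B hB g)
      = ∫ p, B.indicator (fun p => conj (f p.1) * g p.2) p ∂(μ.prod ν) := by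
  have hf : Integrable (fun x => conj (f x)) μ :=
    (Complex.conjCLE : ℂ →L[ℝ] ℂ).integrable_comp ((Lp.memLp f).integrable (by norm_num))
  have hg : Integrable g ν := (Lp.memLp g).integrable (by norm_num)
  rw [L2.inner_def, integral_prod _ ((hf.mul_prod hg).indicator hB)]
  refine integral_congr_ae ?_
  filter_upwards [coeFn_sectionOp (μ := μ) hB g] with x hx
  rw [hx, RCLike.inner_apply', sectionIntegral_eq_indicator hB, ← integral_const_mul]
  congr 1
  funext y
  by_cases h : (x, y) ∈ B <;> simp [h]

theorem inner_sectionOp_left {B : Set (α × β)} (hB : MeasurableSet B) (f : Lp ℂ 2 μ)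
    (g : Lp ℂ 2 ν) : inner ℂ (sectionOp ν μ (Prod.swap ⁻¹' B) (measurable_swap hB) f) g
      = inner ℂ f (sectionOp μ ν B hB g) := by
  rw [inner_sectionOp_right, ← inner_conj_symm, inner_sectionOp_right, ← integral_conj,
    ← integral_prod_swap]
  congr 1
  funext p
  by_cases h : p ∈ B <;> simp [indicator, h, mul_comm]

theorem sectionIntegral_indicatorConstLp {α : Type*} (B : Set (α × β))
    {s : Set β} (hs : MeasurableSet s) (x : α) :
    sectionIntegral ν B (indicatorConstLp 2 hs (measure_ne_top ν s) (1 : ℂ)) x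
      = (ν.real (s ∩ Prod.mk x ⁻¹' B) : ℂ) := by
  rw [sectionIntegral_congr indicatorConstLp_coeFn, sectionIntegral, setIntegral_indicator hs,
    setIntegral_const, inter_comm]
  simp

variable (μ ν) in
/-- The operator from `L²(ν)` to `L²(μ)` with kernel `1_B - c`. -/
noncomputable def centeredOp (B : Set (α × β)) (hB : MeasurableSet B) (c : ℝ) :
    Lp ℂ 2 ν →L[ℂ] Lp ℂ 2 μ :=
  sectionOp μ ν B hB - (c : ℂ) • sectionOp μ ν univ MeasurableSet.univ

theorem isCompactOperator_centeredOp {B : Set (α × β)} (hB : MeasurableSet B) (c : ℝ) :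
    IsCompactOperator (centeredOp μ ν B hB c) :=
  (isCompactOperator_sectionOp hB).sub
    ((isCompactOperator_sectionOp (μ := μ) (ν := ν) MeasurableSet.univ).smul (c : ℂ))

theorem adjoint_centeredOp {B : Set (α × β)} (hB : MeasurableSet B) (c : ℝ) :
    ContinuousLinearMap.adjoint (centeredOp μ ν B hB c)
      = centeredOp ν μ (Prod.swap ⁻¹' B) (measurable_swap hB) c := by
  refine ((ContinuousLinearMap.eq_adjoint_iff _ _).2 fun f g => ?_).symm
  have h := inner_sectionOp_left (μ := μ) (ν := ν) MeasurableSet.univ f g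
  simp only [preimage_univ] at h
  simp only [centeredOp, _root_.sub_apply, _root_.smul_apply, inner_sub_left, inner_sub_right,
    inner_smul_left, inner_smul_right, inner_sectionOp_left hB f g, h, Complex.conj_ofReal]

theorem centeredOp_indicatorConstLp {B : Set (α × β)} (hB : MeasurableSet B) (c : ℝ)
    {s : Set β} (hs : MeasurableSet s) :
    centeredOp μ ν B hB c (indicatorConstLp 2 hs (measure_ne_top ν s) (1 : ℂ))
      =ᵐ[μ] fun x => ((ν.real (s ∩ Prod.mk x ⁻¹' B) - c * ν.real s : ℝ) : ℂ) := by
  set g := indicatorConstLp 2 hs (measure_ne_top ν s) (1 : ℂ)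
  filter_upwards [coeFn_sectionOp (μ := μ) hB g,
    coeFn_sectionOp (μ := μ) (MeasurableSet.univ (α := α × β)) g,
    Lp.coeFn_sub (sectionOp μ ν B hB g) ((c : ℂ) • sectionOp μ ν univ MeasurableSet.univ g),
    Lp.coeFn_smul (c : ℂ) (sectionOp μ ν univ MeasurableSet.univ g)] with x h1 h2 h3 h4
  rw [centeredOp, _root_.sub_apply, _root_.smul_apply, h3, Pi.sub_apply, h1, h4, Pi.smul_apply, h2,
    sectionIntegral_indicatorConstLp B hs,
    sectionIntegral_indicatorConstLp _ hs]
  simp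

/-- Substitute `y ↦ S y` in the integral over the section at `T x`: by invariance, `(T x, S y)` lies
in `B` exactly when `(x, y)` does. -/
theorem sectionOp_compMeasurePreserving {T : α → α} {S : β → β} (hT : MeasurePreserving T μ μ)
    (hS : MeasurePreserving S ν ν) {B : Set (α × β)} (hB : MeasurableSet B)
    (hinv : Prod.map T S ⁻¹' B = B) (g : Lp ℂ 2 ν) :
    sectionOp μ ν B hB (Lp.compMeasurePreserving S hS g)
      = Lp.compMeasurePreserving T hT (sectionOp μ ν B hB g) := by
  refine Lp.ext ?_
  filter_upwards [coeFn_sectionOp (μ := μ) hB (Lp.compMeasurePreserving S hS g),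
    Lp.coeFn_compMeasurePreserving (sectionOp μ ν B hB g) hT,
    hT.quasiMeasurePreserving.ae (coeFn_sectionOp (μ := μ) hB g)] with x h1 h2 h3
  rw [h1, h2, Function.comp_apply, h3, sectionIntegral_congr (Lp.coeFn_compMeasurePreserving g hS),
    sectionIntegral_eq_indicator hB, sectionIntegral_eq_indicator hB]
  have hm : AEStronglyMeasurable (fun y => B.indicator (fun p => g p.2) (T x, y)) ν := by
    have : (fun y => B.indicator (fun p => g p.2) (T x, y)) = (Prod.mk (T x) ⁻¹' B).indicator g :=
      rfl
    rw [this]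
    exact (Lp.aestronglyMeasurable g).indicator (measurable_prodMk_left hB)
  have hcomp : ∀ F : β → ℂ, AEStronglyMeasurable F ν → ∫ y, F y ∂ν = ∫ y, F (S y) ∂ν :=
    fun F hF => by
      have := integral_map (f := F) hS.aemeasurable (by rwa [hS.map_eq])
      rwa [hS.map_eq] at this
  rw [hcomp _ hm]
  congr 1
  funext y
  have : (x, y) ∈ B ↔ (T x, S y) ∈ B := by
    conv_lhs => rw [← hinv]
    rfl
  by_cases h : (x, y) ∈ B
  · simp [h, this.1 h]
  · simp [h, mt this.2 h]

theorem centeredOp_compMeasurePreserving {T : α → α} {S : β → β} (hT : MeasurePreserving T μ μ)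
    (hS : MeasurePreserving S ν ν) {B : Set (α × β)} (hB : MeasurableSet B)
    (hinv : Prod.map T S ⁻¹' B = B) (c : ℝ) (g : Lp ℂ 2 ν) :
    centeredOp μ ν B hB c (Lp.compMeasurePreserving S hS g)
      = Lp.compMeasurePreserving T hT (centeredOp μ ν B hB c g) := by
  have h : Lp.compMeasurePreserving T hT ((c : ℂ) • sectionOp μ ν univ MeasurableSet.univ g)
      = (c : ℂ) • Lp.compMeasurePreserving T hT (sectionOp μ ν univ MeasurableSet.univ g) :=
    (Lp.compMeasurePreservingₗ (E := ℂ) (p := 2) ℂ T hT).map_smul _ _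
  simp only [centeredOp, _root_.sub_apply, _root_.smul_apply, map_sub, h,
    sectionOp_compMeasurePreserving hT hS hB hinv,
    sectionOp_compMeasurePreserving hT hS MeasurableSet.univ preimage_univ]

/-- If almost every horizontal section of the invariant set `B` has measure `c` and all
eigenfunctions of `T` are constant, then the adjoint of the centered operator of `B` vanishes. -/
theorem adjoint_centeredOp_eq_zero {T : α → α} {S : β → β} (hT : MeasurePreserving T μ μ)
    (hS : MeasurePreserving S ν ν)
    (hwm : ∀ f : α → ℂ, Measurable f → (∃ l : ℂ, ∀ᵐ x ∂μ, f (T x) = l * f x) →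
      ∃ c : ℂ, ∀ᵐ x ∂μ, f x = c)
    {B : Set (α × β)} (hB : MeasurableSet B) (hinv : Prod.map T S ⁻¹' B = B) {c : ℝ}
    (hc : ∀ᵐ y ∂ν, μ.real (Prod.mk y ⁻¹' (Prod.swap ⁻¹' B)) = c) (f : Lp ℂ 2 μ) :
    ContinuousLinearMap.adjoint (centeredOp μ ν B hB c) f = 0 := by
  set Ψ := centeredOp μ ν B hB c with hΨ
  set one : Lp ℂ 2 μ := indicatorConstLp 2 MeasurableSet.univ (measure_ne_top μ univ) (1 : ℂ)
    with hone
  have hBs : MeasurableSet (Prod.swap ⁻¹' B) := measurable_swap hB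
  have hinv' : Prod.map S T ⁻¹' (Prod.swap ⁻¹' B) = Prod.swap ⁻¹' B := by
    conv_rhs => rw [← hinv]
    rfl
  -- Subtracting `c`, the measure of almost every section, is what makes constants disappear.
  have hone0 : ContinuousLinearMap.adjoint Ψ one = 0 := by
    rw [hΨ, adjoint_centeredOp]
    refine Lp.ext ?_
    filter_upwards [centeredOp_indicatorConstLp (μ := ν) (ν := μ) hBs c MeasurableSet.univ, hc,
      Lp.coeFn_zero ℂ 2 ν] with y h1 h2 h3
    rw [h1, h3, univ_inter, h2]
    simp
  set K := Ψ ∘L ContinuousLinearMap.adjoint Ψ with hK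
  have hKzero : K = 0 := by
    by_contra hne
    have hΨc : IsCompactOperator Ψ := isCompactOperator_centeredOp hB c
    have hcpt : IsCompactOperator K := hΨc.comp_clm (ContinuousLinearMap.adjoint Ψ)
    have hsymm : K.IsSymmetric := (ContinuousLinearMap.isPositive_self_comp_adjoint Ψ).isSymmetric
    set U : Lp ℂ 2 μ →L[ℂ] Lp ℂ 2 μ :=
      (Lp.compMeasurePreservingₗᵢ ℂ T hT).toContinuousLinearMap with hU
    have hUapp : ∀ v, U v = Lp.compMeasurePreserving T hT v := fun v => rfl
    have hcomm : ∀ v, K (U v) = U (K v) := fun v => by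
      rw [hUapp, hUapp, hK, ContinuousLinearMap.comp_apply, ContinuousLinearMap.comp_apply, hΨ,
        adjoint_centeredOp, centeredOp_compMeasurePreserving hS hT hBs hinv',
        centeredOp_compMeasurePreserving hT hS hB hinv]
    -- The vector `v` is an eigenfunction of `T`, hence constant by `hwm`, hence killed by `K`; this
    -- contradicts `K v = κ • v ≠ 0`.
    obtain ⟨v, hv0, ⟨κ, hκ, hKv⟩, l, hl⟩ := exists_common_eigenvector hcpt hsymm hne hcomm
    obtain ⟨d, hd⟩ := hwm v (Lp.stronglyMeasurable v).measurable ⟨l, by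
      filter_upwards [Lp.coeFn_compMeasurePreserving v hT, Lp.coeFn_smul l v] with x h1 h2
      rw [← hUapp, hl, h2] at h1
      simpa using h1.symm⟩
    have hvd : v = d • one := by
      refine Lp.ext ?_
      filter_upwards [hd, Lp.coeFn_smul d one, indicatorConstLp_coeFn (p := 2)
        (hs := MeasurableSet.univ) (hμs := measure_ne_top μ univ) (c := (1 : ℂ))] with x h1 h2 h3
      rw [h1, h2, Pi.smul_apply, hone, h3]
      simp
    have : K v = 0 := by
      rw [hvd, map_smul, hK, ContinuousLinearMap.comp_apply, hone0, map_zero, smul_zero]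
    rw [hKv] at this
    exact (smul_ne_zero hκ hv0) this
  -- The inner product of `f` with `K f` is the squared norm of `Ψ* f`.
  have h1 : inner ℂ f (K f) = 0 := by rw [hKzero]; simp
  rw [hK, ContinuousLinearMap.comp_apply, ← ContinuousLinearMap.adjoint_inner_left] at h1
  exact inner_self_eq_zero.1 h1

/-- The product of a measure preserving map all of whose eigenfunctions are constant with an
ergodic map is ergodic. -/
theorem ergodic_prodMap {T : α → α} {S : β → β} (hT : MeasurePreserving T μ μ)
    (hS : Ergodic S ν)
    (hwm : ∀ f : α → ℂ, Measurable f → (∃ l : ℂ, ∀ᵐ x ∂μ, f (T x) = l * f x) →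
      ∃ c : ℂ, ∀ᵐ x ∂μ, f x = c) :
    Ergodic (Prod.map T S) (μ.prod ν) := by
  refine ⟨hT.prod hS.toMeasurePreserving, ⟨fun B hB hinv => ?_⟩⟩
  have hBs : MeasurableSet (Prod.swap ⁻¹' B) := measurable_swap hB
  -- The measure of the section at `y` is an `S`-invariant function of `y`, since `T` preserves `μ`;
  -- ergodicity of `S` makes it constant.
  obtain ⟨c, hc⟩ : ∃ c : ℝ≥0∞, (fun y => μ (Prod.mk y ⁻¹' (Prod.swap ⁻¹' B)))
      =ᵐ[ν] Function.const β c := by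
    refine hS.toPreErgodic.ae_eq_const_of_ae_eq_comp (measurable_measure_prodMk_left hBs) ?_
    funext y
    rw [Function.comp_apply, ← hT.measure_preimage (measurable_prodMk_left hBs).nullMeasurableSet]
    conv_rhs => rw [← hinv]
    rfl
  have hctop : c ≠ ∞ := by
    obtain ⟨y, hy⟩ := hc.exists
    rw [← show μ (Prod.mk y ⁻¹' (Prod.swap ⁻¹' B)) = c from hy]
    exact measure_ne_top _ _
  -- Vanishing of the adjoint on `1_s` says that almost every section of `B` meets `s` in measure `c
  -- * μ s`; integrating over `t` gives the rectangle formula.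
  have hrect : ∀ s t, MeasurableSet s → MeasurableSet t →
      ((μ.prod ν).restrict B) (s ×ˢ t) = (c • μ) s * ν t := by
    intro s t hs ht
    have hz := adjoint_centeredOp_eq_zero hT hS.toMeasurePreserving hwm hB hinv (c := c.toReal)
      (by filter_upwards [hc] with y hy; rw [measureReal_def, hy]; rfl)
      (indicatorConstLp 2 hs (measure_ne_top μ s) (1 : ℂ))
    rw [adjoint_centeredOp] at hz
    have hsec : ∀ᵐ y ∂ν, μ (s ∩ Prod.mk y ⁻¹' (Prod.swap ⁻¹' B)) = c * μ s := by
      have h := centeredOp_indicatorConstLp (μ := ν) (ν := μ) hBs c.toReal hs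
      rw [hz] at h
      filter_upwards [h, Lp.coeFn_zero ℂ 2 ν] with y h1 h2
      rw [h2, Pi.zero_apply, eq_comm, Complex.ofReal_eq_zero, sub_eq_zero, measureReal_def,
        measureReal_def, ← ENNReal.toReal_mul] at h1
      exact (ENNReal.toReal_eq_toReal_iff' (measure_ne_top _ _)
        (ENNReal.mul_ne_top hctop (measure_ne_top _ _))).1 h1
    rw [Measure.restrict_apply (hs.prod ht), Measure.prod_apply_symm ((hs.prod ht).inter hB)]
    have : ∀ᵐ y ∂ν, μ ((fun x => (x, y)) ⁻¹' (s ×ˢ t ∩ B))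
        = t.indicator (fun _ => c * μ s) y := by
      filter_upwards [hsec] with y hy
      by_cases hyt : y ∈ t
      · rw [indicator_of_mem hyt, ← hy]
        congr 1
        ext x
        simp [hyt]
      · rw [indicator_of_notMem hyt]
        convert measure_empty (μ := μ)
        ext x
        simp [hyt]
    rw [lintegral_congr_ae this, lintegral_indicator_const ht]
    simp
  have hprod : (c • μ).prod ν = (μ.prod ν).restrict B := by
    have : IsFiniteMeasure (c • μ) := ⟨by
      simpa using hctop.lt_top⟩
    exact Measure.prod_eq hrect
  -- Evaluating both measures at `Bᶜ`, which the restriction to `B` does not charge, leaves `c = 0`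
  -- (then `B` is null) or `Bᶜ` null.
  have h0 : c * (μ.prod ν) Bᶜ = 0 := by
    have h := congrArg (fun m : Measure (α × β) => m Bᶜ) hprod
    simp only [Measure.prod_smul_left, Measure.restrict_apply hB.compl, compl_inter_self,
      measure_empty, Measure.smul_apply, smul_eq_mul] at h
    exact h
  rw [eventuallyConst_set']
  rcases mul_eq_zero.1 h0 with hc0 | hBc
  · left
    rw [ae_eq_empty]
    have h := congrArg (fun m : Measure (α × β) => m univ) hprod
    simpa [hc0] using h.symm
  · right
    rwa [ae_eq_univ]

end SectionOperator
end CapacitySystem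
namespace CapacitySystem
open MeasureTheory Filter Set Topology
open scoped ENNReal

/-! ### Upper probabilities, invariant core elements and control measures -/

section UpperProbability

variable {Ω : Type*} [MeasurableSpace Ω]

theorem isCapacity_toSetFun (P : ProbabilityMeasure Ω) : IsCapacity (toSetFun P) where
  empty := measureReal_empty
  univ := probReal_univ
  mono _ _ _ _ h := measureReal_mono h

theorem isAdditive_toSetFun (P : ProbabilityMeasure Ω) : IsAdditive (toSetFun P) :=
  fun _ _ _ hB h => measureReal_union h hB

variable {V : Set Ω → ℝ} {T : Ω → Ω}

theorem IsCapacity.nonneg (hV : IsCapacity V) {A : Set Ω} (hA : MeasurableSet A) : 0 ≤ V A := by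
  rw [← hV.empty]
  exact hV.mono _ _ MeasurableSet.empty hA (empty_subset A)

/-- The maximum defining an upper probability is attained at an element of the core. -/
theorem IsUpperProbability.exists_mem_core_eq (hV : IsUpperProbability V) {A : Set Ω}
    (hA : MeasurableSet A) : ∃ P : ProbabilityMeasure Ω, toSetFun P ∈ core V ∧ toSetFun P A = V A := by
  obtain ⟨-, Λ, -, hmax⟩ := hV
  obtain ⟨P, hP, hPA⟩ := (hmax A hA).1
  exact ⟨P, ⟨isCapacity_toSetFun P, isAdditive_toSetFun P,
    fun B hB => (hmax B hB).2 ⟨P, hP, rfl⟩⟩, hPA⟩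

/-- An upper probability is continuous from above at sets of capacity zero. -/
theorem IsUpperProbability.exists_lt_of_antitone (hV : IsUpperProbability V) {s : ℕ → Set Ω}
    (hs : ∀ n, MeasurableSet (s n)) (hanti : Antitone s) (h0 : V (⋂ n, s n) = 0) {ε : ℝ}
    (hε : 0 < ε) : ∃ n, V (s n) < ε := by
  by_contra! hge
  obtain ⟨-, Λ, hΛ, hmax⟩ := hV
  let _ : TopologicalSpace (ProbabilityMeasure Ω) := weakStarTopology Ω
  have hind : Continuous fun (P : ProbabilityMeasure Ω) (A : {A : Set Ω // MeasurableSet A}) =>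
      toSetFun P A.1 := continuous_induced_dom
  have hcont : ∀ A : Set Ω, MeasurableSet A →
      Continuous fun P : ProbabilityMeasure Ω => toSetFun P A := fun A hA =>
    (continuous_apply (⟨A, hA⟩ : {A : Set Ω // MeasurableSet A})).comp hind
  obtain ⟨P, hPΛ, hP⟩ := hΛ.inter_iInter_nonempty
    (fun n => {P : ProbabilityMeasure Ω | ε ≤ toSetFun P (s n)})
    (fun n => isClosed_le continuous_const (hcont _ (hs n))) fun u => by
      -- `u.sup id` is the largest index in `u` (and `0` for empty `u`), so its set is contained in
      -- all the others; a maximizer for it lies in the whole finite intersection.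
      obtain ⟨P, hP, hPs⟩ := (hmax _ (hs (u.sup id))).1
      refine ⟨P, hP, mem_iInter₂.2 fun n hn => ?_⟩
      calc ε ≤ V (s (u.sup id)) := hge _
        _ = toSetFun P (s (u.sup id)) := hPs.symm
        _ ≤ toSetFun P (s n) := measureReal_mono (hanti (Finset.le_sup (f := id) hn))
  have hlim : Tendsto (fun n => toSetFun P (s n)) atTop (𝓝 (toSetFun P (⋂ n, s n))) :=
    (ENNReal.tendsto_toReal (measure_ne_top _ _)).comp
      (tendsto_measure_iInter_atTop (fun n => (hs n).nullMeasurableSet) hanti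
        ⟨0, measure_ne_top _ _⟩)
  have h1 : ε ≤ toSetFun P (⋂ n, s n) :=
    ge_of_tendsto' hlim fun n => mem_iInter.1 hP n
  have h2 : toSetFun P (⋂ n, s n) ≤ V (⋂ n, s n) :=
    (hmax _ (MeasurableSet.iInter hs)).2 ⟨P, hPΛ, rfl⟩
  linarith

theorem IsUpperProbability.eq_one_of_compl (hV : IsUpperProbability V) {A : Set Ω}
    (hA : MeasurableSet A) (h : V Aᶜ = 0) : V A = 1 := by
  obtain ⟨P, hP, -⟩ := hV.exists_mem_core_eq hA
  have h1 : toSetFun P (A ∪ Aᶜ) = _ := hP.2.1 A Aᶜ hA hA.compl disjoint_compl_right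
  rw [union_compl_self, hP.1.univ] at h1
  have h2 := hP.2.2 A hA
  have h3 := hP.2.2 Aᶜ hA.compl
  have h4 := hV.1.mono A univ hA MeasurableSet.univ (subset_univ A)
  rw [hV.1.univ] at h4
  linarith

/-- An additive set function dominated by an upper probability is a probability measure. -/
theorem IsUpperProbability.exists_probabilityMeasure (hV : IsUpperProbability V) {q : Set Ω → ℝ}
    (hq : q ∈ core V) :
    ∃ Q : ProbabilityMeasure Ω, ∀ A, MeasurableSet A → toSetFun Q A = q A := by
  obtain ⟨hcap, hadd, hle⟩ := hq
  have hring : IsSetRing {A : Set Ω | MeasurableSet A} :=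
    ⟨MeasurableSet.empty, fun _ _ hs ht => hs.union ht, fun _ _ hs ht => hs.diff ht⟩
  set m : AddContent ℝ≥0∞ {A : Set Ω | MeasurableSet A} :=
    hring.addContent_of_union (fun A => ENNReal.ofReal (q A)) (by simp [hcap.empty])
      (fun {s t} hs ht hd => by
        rw [hadd s t hs ht hd, ENNReal.ofReal_add (hcap.nonneg hs) (hcap.nonneg ht)]) with hm
  have hmA : ∀ A, m A = ENNReal.ofReal (q A) := fun A => rfl
  -- Domination by `V` gives continuity from above at `∅`, which for a finitely additive content is
  -- countable additivity.
  have hcont : ∀ ⦃s : ℕ → Set Ω⦄ (_ : ∀ n, s n ∈ {A : Set Ω | MeasurableSet A}), Antitone s →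
      (⋂ n, s n) = ∅ → Tendsto (fun n ↦ m (s n)) atTop (𝓝 0) := by
    intro s hs hanti hempty
    simp_rw [hmA]
    rw [← ENNReal.ofReal_zero]
    refine (ENNReal.continuous_ofReal.tendsto _).comp ?_
    refine Metric.tendsto_atTop.2 fun ε hε => ?_
    obtain ⟨N, hN⟩ := hV.exists_lt_of_antitone hs hanti (by rw [hempty, hV.1.empty]) hε
    refine ⟨N, fun n hn => ?_⟩
    rw [Real.dist_eq, sub_zero, abs_of_nonneg (hcap.nonneg (hs n))]
    exact ((hcap.mono _ _ (hs n) (hs N) (hanti hn)).trans (hle _ (hs N))).trans_lt hN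
  let Q : Measure Ω := Measure.ofMeasurable (fun A _ => m A) (by simp)
    (fun f hf hd => addContent_iUnion_eq_sum_of_tendsto_zero hring m
      (fun _ _ => ENNReal.ofReal_ne_top) hcont hf (MeasurableSet.iUnion hf) hd)
  have hQ : ∀ A, MeasurableSet A → Q A = ENNReal.ofReal (q A) := fun A hA =>
    Measure.ofMeasurable_apply A hA
  refine ⟨⟨Q, ⟨by rw [hQ _ MeasurableSet.univ, hcap.univ, ENNReal.ofReal_one]⟩⟩, fun A hA => ?_⟩
  change (Q A).toReal = q A
  rw [hQ A hA, ENNReal.toReal_ofReal (hcap.nonneg hA)]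

/-- The core of an invariant upper probability contains an invariant probability measure. -/
theorem IsUpperProbability.exists_invariant (hV : IsUpperProbability V)
    (hVT : IsCapacityPreserving V T) :
    ∃ Q : ProbabilityMeasure Ω, toSetFun Q ∈ core V ∧ MeasurePreserving T (Q : Measure Ω) Q := by
  obtain ⟨P, hP, -⟩ := hV.exists_mem_core_eq MeasurableSet.univ
  have hT := hVT.measurable
  -- Cesàro averages over `n + 1` terms, so that the denominator never vanishes.
  set a : Set Ω → ℕ → ℝ := fun A n =>
    (∑ k ∈ Finset.range (n + 1), toSetFun P (T^[k] ⁻¹' A)) / (n + 1) with ha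
  have hpos : ∀ n : ℕ, (0 : ℝ) < n + 1 := fun n => by positivity
  have hP0 : ∀ A, 0 ≤ toSetFun P A := fun A => measureReal_nonneg
  have hP1 : ∀ A, toSetFun P A ≤ 1 := fun A => measureReal_le_one
  have ha_le : ∀ A (C : ℝ), (∀ k, toSetFun P (T^[k] ⁻¹' A) ≤ C) → ∀ n, a A n ≤ C := by
    intro A C h n
    rw [ha, div_le_iff₀ (hpos n)]
    refine (Finset.sum_le_card_nsmul _ _ C fun k _ => h k).trans (le_of_eq ?_)
    simp [mul_comm]
  have ha0 : ∀ A n, 0 ≤ a A n := fun A n =>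
    div_nonneg (Finset.sum_nonneg fun k _ => hP0 _) (hpos n).le
  -- A nonprincipal ultrafilter provides limits for all sets simultaneously, since the averages stay
  -- in `[0, 1]`; limits along it respect sums and inequalities.
  have hlim : ∀ A, ∃ x, Tendsto (a A) (hyperfilter ℕ : Filter ℕ) (𝓝 x) := by
    intro A
    obtain ⟨x, -, hx⟩ := (isCompact_Icc (a := (0 : ℝ)) (b := 1)).ultrafilter_le_nhds
      ((hyperfilter ℕ).map (a A)) (by
        refine le_principal_iff.2 (Eventually.of_forall (f := (hyperfilter ℕ : Filter ℕ))
          fun n => ⟨ha0 A n, ha_le A 1 (fun k => hP1 _) n⟩))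
    exact ⟨x, hx⟩
  choose q hq using hlim
  have hq0 : ∀ A, 0 ≤ q A := fun A => ge_of_tendsto' (hq A) (ha0 A)
  have hadd : IsAdditive q := by
    intro A B hA hB hd
    refine tendsto_nhds_unique (hq (A ∪ B)) (((hq A).add (hq B)).congr fun n => ?_)
    rw [ha, ← add_div, ← Finset.sum_add_distrib]
    congr 1
    refine Finset.sum_congr rfl fun k _ => ?_
    exact (hP.2.1 _ _ (hT.iterate k hA) (hT.iterate k hB) (hd.preimage _)).symm
  have hempty : q ∅ = 0 :=
    tendsto_nhds_unique (hq ∅) (tendsto_const_nhds.congr fun n => by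
      simp [ha, hP.1.empty])
  have huniv : q univ = 1 :=
    tendsto_nhds_unique (hq univ) (tendsto_const_nhds.congr fun n => by
      simp [ha, hP.1.univ, (hpos n).ne'])
  have hmono : ∀ A B : Set Ω, MeasurableSet A → MeasurableSet B → A ⊆ B → q A ≤ q B := by
    intro A B hA hB hAB
    have := hadd A (B \ A) hA (hB.diff hA) disjoint_sdiff_right
    rw [union_sdiff_cancel hAB] at this
    linarith [hq0 (B \ A)]
  have hVk : ∀ (k : ℕ) A, MeasurableSet A → V (T^[k] ⁻¹' A) = V A := by
    intro k
    induction k with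
    | zero => intro A _; rfl
    | succ k ih =>
      intro A hA
      rw [Function.iterate_succ', preimage_comp, ih _ (hT hA), hVT.invariant A hA]
  have hqV : ∀ A, MeasurableSet A → q A ≤ V A := fun A hA =>
    le_of_tendsto' (hq A) (ha_le A (V A) fun k =>
      (hP.2.2 _ (hT.iterate k hA)).trans (hVk k A hA).le)
  have hcore : q ∈ core V := ⟨⟨hempty, huniv, hmono⟩, hadd, hqV⟩
  -- The two averages differ by a telescoping sum, bounded by `1 / (n + 1)`.
  have hinv : ∀ A, q (T ⁻¹' A) = q A := by
    intro A
    have hdiff : Tendsto (fun n => a (T ⁻¹' A) n - a A n) (hyperfilter ℕ : Filter ℕ) (𝓝 0) := by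
      refine Tendsto.mono_left ?_ Nat.hyperfilter_le_atTop
      refine squeeze_zero_norm (fun n => ?_) tendsto_one_div_add_atTop_nhds_zero_nat
      have hs : ∀ k, toSetFun P (T^[k] ⁻¹' (T ⁻¹' A)) = toSetFun P (T^[k + 1] ⁻¹' A) := fun k => by
        rw [Function.iterate_succ', preimage_comp]
      simp only [ha, hs]
      rw [← sub_div, ← Finset.sum_sub_distrib,
        Finset.sum_range_sub (fun k => toSetFun P (T^[k] ⁻¹' A)), norm_div, Real.norm_eq_abs,
        Real.norm_of_nonneg (hpos n).le]
      gcongr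
      exact abs_sub_le_of_nonneg_of_le (hP0 _) (hP1 _) (hP0 _) (hP1 _)
    have := tendsto_nhds_unique hdiff ((hq (T ⁻¹' A)).sub (hq A))
    linarith
  obtain ⟨Q, hQ⟩ := hV.exists_probabilityMeasure hcore
  refine ⟨Q, ⟨isCapacity_toSetFun Q, isAdditive_toSetFun Q, fun A hA => ?_⟩, hT, ?_⟩
  · rw [hQ A hA]
    exact hqV A hA
  · ext A hA
    rw [Measure.map_apply hT hA]
    refine (measureReal_eq_measureReal_iff).1 ?_
    have h1 := hQ _ (hT hA)
    have h2 := hQ A hA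
    exact h1.trans ((hinv A).trans h2.symm)

/-- A probability measure in the core of `V` with the same null sets as `V`. -/
structure IsControlMeasure (V : Set Ω → ℝ) (Q : ProbabilityMeasure Ω) : Prop where
  mem_core : toSetFun Q ∈ core V
  null : ∀ A, MeasurableSet A → (Q : Measure Ω) A = 0 → V A = 0

theorem measure_eq_zero_of_mem_core {P : ProbabilityMeasure Ω} (hP : toSetFun P ∈ core V)
    {A : Set Ω} (hA : MeasurableSet A) (h : V A = 0) : (P : Measure Ω) A = 0 := by
  have h1 : (P : Measure Ω).real A ≤ V A := hP.2.2 A hA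
  rw [h] at h1
  exact (measureReal_eq_zero_iff).1 (le_antisymm h1 measureReal_nonneg)

theorem IsControlMeasure.almostSurely_iff {Q : ProbabilityMeasure Ω} (hQ : IsControlMeasure V Q)
    {p : Ω → Prop} : AlmostSurely V p ↔ ∀ᵐ ω ∂(Q : Measure Ω), p ω := by
  constructor
  · rintro ⟨A, hA, hA0, hp⟩
    exact measure_mono_null (fun ω hω hωA => hω (hp ω hωA))
      (measure_eq_zero_of_mem_core hQ.mem_core hA.compl hA0)
  · intro h
    refine ⟨(toMeasurable (Q : Measure Ω) {ω | ¬ p ω})ᶜ, (measurableSet_toMeasurable _ _).compl,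
      ?_, fun ω hω => ?_⟩
    · rw [compl_compl]
      refine hQ.null _ (measurableSet_toMeasurable _ _) ?_
      rw [measure_toMeasurable]
      exact h
    · by_contra hp
      exact hω (subset_toMeasurable _ _ hp)

/-- If every invariant set or its complement is `V`-null, then `V` is controlled by an invariant
ergodic probability measure in its core. -/
theorem IsUpperProbability.exists_ergodic_isControlMeasure (hV : IsUpperProbability V)
    (hVT : IsCapacityPreserving V T)
    (herg : ∀ B : Set Ω, MeasurableSet B → T ⁻¹' B = B → V B = 0 ∨ V Bᶜ = 0) :
    ∃ Q : ProbabilityMeasure Ω, IsControlMeasure V Q ∧ Ergodic T (Q : Measure Ω) := by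
  obtain ⟨Q, hQ, hQT⟩ := hV.exists_invariant hVT
  have hT := hVT.measurable
  refine ⟨Q, ⟨hQ, fun A hA hQA => ?_⟩, hQT, ⟨fun B hB hinv => ?_⟩⟩
  -- `s n` is the union of the preimages of `A` under the iterates of order at least `n`. Its
  -- intersection over `n`, the limsup of these preimages, is strictly invariant, so `herg` applies
  -- to it.
  · set s : ℕ → Set Ω := fun n => ⋃ k, T^[n + k] ⁻¹' A with hs
    have hsm : ∀ n, MeasurableSet (s n) := fun n =>
      MeasurableSet.iUnion fun k => hT.iterate (n + k) hA
    have hpre : ∀ n, T ⁻¹' s n = s (n + 1) := fun n => by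
      simp only [hs, preimage_iUnion, ← preimage_comp, ← Function.iterate_succ]
      congr 1
      funext k
      rw [show (n + k).succ = n + 1 + k by omega]
    have hanti : Antitone s := by
      refine antitone_nat_of_succ_le fun n => ?_
      refine iUnion_subset fun k => ?_
      rw [show n + 1 + k = n + (k + 1) by omega]
      exact subset_iUnion (fun k => T^[n + k] ⁻¹' A) (k + 1)
    have hLinv : T ⁻¹' (⋂ n, s n) = ⋂ n, s n := by
      simp only [preimage_iInter, hpre]
      exact hanti.iInter_nat_add 1
    have hQs : (Q : Measure Ω) (s 0) = 0 := by
      refine measure_iUnion_null fun k => ?_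
      rw [(hQT.iterate (0 + k)).measure_preimage hA.nullMeasurableSet, hQA]
    have hQL : (Q : Measure Ω) (⋂ n, s n) = 0 := measure_mono_null (iInter_subset s 0) hQs
    -- The other alternative would make both the limsup and its complement `Q`-null.
    have hVL : V (⋂ n, s n) = 0 := by
      refine (herg _ (MeasurableSet.iInter hsm) hLinv).resolve_right fun h => ?_
      have h1 := measure_eq_zero_of_mem_core hQ (MeasurableSet.iInter hsm).compl h
      have h2 : (Q : Measure Ω) univ ≤ 0 := by
        rw [← union_compl_self (⋂ n, s n)]
        refine (measure_union_le _ _).trans ?_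
        rw [hQL, h1, add_zero]
      simp at h2
    -- `V A` equals the capacity of the `n`-th preimage of `A`, which lies in `s n`; since `V (s n)`
    -- becomes arbitrarily small, `V A = 0`.
    have hVn : ∀ n, V (T^[n] ⁻¹' A) = V A := fun n => by
      induction n with
      | zero => rfl
      | succ n ih =>
        rw [Function.iterate_succ, preimage_comp, hVT.invariant _ (hT.iterate n hA), ih]
    refine le_antisymm (le_of_forall_pos_le_add fun ε hε => ?_) (hV.1.nonneg hA)
    obtain ⟨n, hn⟩ := hV.exists_lt_of_antitone hsm hanti hVL hε
    rw [zero_add, ← hVn n]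
    refine (hV.1.mono _ _ (hT.iterate n hA) (hsm n) ?_).trans hn.le
    exact subset_iUnion (fun k => T^[n + k] ⁻¹' A) 0
  · rw [eventuallyConst_set', ae_eq_empty, ae_eq_univ]
    exact (herg B hB hinv).imp (measure_eq_zero_of_mem_core hQ hB)
      (measure_eq_zero_of_mem_core hQ hB.compl)

/-- The indicator of an invariant set is an eigenfunction with eigenvalue `1`, and an almost surely
constant indicator makes the set or its complement null. -/
theorem IsWeaklyMixing.zero_or_compl_zero (hV : IsCapacity V) (h : IsWeaklyMixing V T) {B : Set Ω}
    (hB : MeasurableSet B) (hinv : T ⁻¹' B = B) : V B = 0 ∨ V Bᶜ = 0 := by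
  have hmem : ∀ ω, T ω ∈ B ↔ ω ∈ B := fun ω => by
    conv_rhs => rw [← hinv]
    rfl
  obtain ⟨c, A, hA, hA0, hc⟩ := h (B.indicator fun _ => 1) (measurable_const.indicator hB)
    ⟨1, univ, MeasurableSet.univ, by rw [compl_univ, hV.empty], fun ω _ => by
      by_cases hω : ω ∈ B
      · simp [hω, (hmem ω).2 hω]
      · simp [hω, mt (hmem ω).1 hω]⟩
  have hnull : ∀ C, MeasurableSet C → C ⊆ Aᶜ → V C = 0 := fun C hC hCA =>
    le_antisymm (hA0 ▸ hV.mono _ _ hC hA.compl hCA) (hV.nonneg hC)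
  by_cases hc1 : c = 1
  · refine Or.inr (hnull _ hB.compl fun ω hω hωA => ?_)
    have : B.indicator (fun _ => (1 : ℂ)) ω = c := hc ω hωA
    rw [indicator_of_notMem hω, hc1] at this
    exact zero_ne_one this
  · refine Or.inl (hnull _ hB fun ω hω hωA => hc1 ?_)
    rw [← hc ω hωA, indicator_of_mem hω]

end UpperProbability

/-! ### Products of upper probabilities -/

section Product

variable {Ω Ω' : Type*} [MeasurableSpace Ω] [MeasurableSpace Ω'] {V : Set Ω → ℝ} {V' : Set Ω' → ℝ}
  {T : Ω → Ω} {T' : Ω' → Ω'}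

theorem le_prod {P : ProbabilityMeasure Ω} {P' : ProbabilityMeasure Ω'} (hP : toSetFun P ∈ core V)
    (hP' : toSetFun P' ∈ core V') (A : Set (Ω × Ω')) :
    ((P : Measure Ω).prod (P' : Measure Ω')).real A ≤ prod V V' A :=
  le_csSup ⟨1, by rintro r ⟨P, P', -, -, rfl⟩; exact measureReal_le_one⟩ ⟨P, P', hP, hP', rfl⟩

/-- All core elements are absolutely continuous with respect to the control measures, and absolute
continuity passes to products. -/
theorem prod_eq_zero_iff {Q : ProbabilityMeasure Ω} {Q' : ProbabilityMeasure Ω'}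
    (hQ : IsControlMeasure V Q) (hQ' : IsControlMeasure V' Q') (A : Set (Ω × Ω')) :
    prod V V' A = 0 ↔ ((Q : Measure Ω).prod (Q' : Measure Ω')) A = 0 := by
  constructor
  · intro h
    have := le_prod hQ.mem_core hQ'.mem_core A
    rw [h] at this
    exact (measureReal_eq_zero_iff).1 (le_antisymm this measureReal_nonneg)
  · intro h
    have hset : {r : ℝ | ∃ (P₁ : ProbabilityMeasure Ω) (P₂ : ProbabilityMeasure Ω'),
        toSetFun P₁ ∈ core V ∧ toSetFun P₂ ∈ core V' ∧
          r = ((P₁ : Measure Ω).prod (P₂ : Measure Ω')).real A} = {0} := by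
      refine Subset.antisymm ?_ (singleton_subset_iff.2
        ⟨Q, Q', hQ.mem_core, hQ'.mem_core, by rw [measureReal_def, h]; rfl⟩)
      rintro r ⟨P, P', hP, hP', rfl⟩
      have hac : (P : Measure Ω) ≪ Q := Measure.AbsolutelyContinuous.mk fun B hB h0 =>
        measure_eq_zero_of_mem_core hP hB (hQ.null B hB h0)
      have hac' : (P' : Measure Ω') ≪ Q' := Measure.AbsolutelyContinuous.mk fun B hB h0 =>
        measure_eq_zero_of_mem_core hP' hB (hQ'.null B hB h0)
      rw [mem_singleton_iff, measureReal_def, hac.prod hac' h]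
      rfl
    rw [prod, hset, csSup_singleton]

theorem prod_eq_one_of_compl (hV : IsUpperProbability V) (hV' : IsUpperProbability V')
    {A : Set (Ω × Ω')} (hA : MeasurableSet A) (h : prod V V' Aᶜ = 0) : prod V V' A = 1 := by
  obtain ⟨P, hP, -⟩ := hV.exists_mem_core_eq MeasurableSet.univ
  obtain ⟨P', hP', -⟩ := hV'.exists_mem_core_eq MeasurableSet.univ
  have h1 := le_prod hP hP' Aᶜ
  have h2 := le_prod hP hP' A
  rw [h, measureReal_compl hA, probReal_univ] at h1
  refine le_antisymm (csSup_le ⟨_, P, P', hP, hP', rfl⟩ ?_) (by linarith)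
  rintro r ⟨P, P', -, -, rfl⟩
  exact measureReal_le_one

theorem isErgodic_prod_iff (hV : IsUpperProbability V) (hV' : IsUpperProbability V')
    {Q : ProbabilityMeasure Ω} {Q' : ProbabilityMeasure Ω'}
    (hQ : IsControlMeasure V Q) (hQ' : IsControlMeasure V' Q')
    (hT : MeasurePreserving T (Q : Measure Ω) Q) (hT' : MeasurePreserving T' (Q' : Measure Ω') Q') :
    IsErgodic (prod V V') (Prod.map T T') ↔
      Ergodic (Prod.map T T') ((Q : Measure Ω).prod (Q' : Measure Ω')) := by
  constructor
  · intro h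
    refine ⟨hT.prod hT', ⟨fun B hB hinv => ?_⟩⟩
    rw [eventuallyConst_set', ae_eq_empty, ae_eq_univ, ← prod_eq_zero_iff hQ hQ',
      ← prod_eq_zero_iff hQ hQ']
    exact (h B hB hinv).2
  · intro h B hB hinv
    have h0 := h.toPreErgodic.measure_self_or_compl_eq_zero hB hinv
    rw [← prod_eq_zero_iff hQ hQ', ← prod_eq_zero_iff hQ hQ'] at h0
    exact ⟨h0.imp_right (prod_eq_one_of_compl hV hV' hB), h0⟩

/-- Cylinders over invariant sets are invariant, and every core element of `V` is the marginal of
one of the products defining `prod V V'`, so a null cylinder has a `V`-null base. -/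
theorem isErgodic_of_prod (hV : IsUpperProbability V) (hV' : IsUpperProbability V')
    (h : IsErgodic (prod V V') (Prod.map T T')) : IsErgodic V T := by
  obtain ⟨P', hP', -⟩ := hV'.exists_mem_core_eq MeasurableSet.univ
  have hzero : ∀ B : Set Ω, MeasurableSet B → prod V V' (Prod.fst ⁻¹' B) = 0 → V B = 0 := by
    intro B hB h0
    obtain ⟨P, hP, hPB⟩ := hV.exists_mem_core_eq hB
    have h1 := le_prod hP hP' (Prod.fst ⁻¹' B)
    have h2 : ((P : Measure Ω).prod (P' : Measure Ω')).real (Prod.fst ⁻¹' B) = V B := by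
      rw [← prod_univ, measureReal_prod_prod, probReal_univ, mul_one]
      exact hPB
    rw [h0, h2] at h1
    exact le_antisymm h1 (hV.1.nonneg hB)
  intro B hB hinv
  have h0 := (h (Prod.fst ⁻¹' B) (measurable_fst hB) (by
    conv_rhs => rw [← hinv]
    rfl)).2
  have h1 : V B = 0 ∨ V Bᶜ = 0 := h0.imp (hzero B hB) (hzero Bᶜ hB.compl)
  exact ⟨h1.imp_right (hV.eq_one_of_compl hB), h1⟩

theorem isUpperProbability_toSetFun (P : ProbabilityMeasure Ω) :
    IsUpperProbability (toSetFun P) := by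
  let _ : TopologicalSpace (ProbabilityMeasure Ω) := weakStarTopology Ω
  refine ⟨isCapacity_toSetFun P, {P}, isCompact_singleton, fun A _ => ?_⟩
  rw [image_singleton]
  exact isGreatest_singleton

/-- Eigenfunctions of a measure preserving map with ergodic square are constant. -/
theorem ae_eq_const_of_ergodic_prodMap {μ : Measure Ω} [IsProbabilityMeasure μ]
    (hT : MeasurePreserving T μ μ) (h : Ergodic (Prod.map T T) (μ.prod μ)) {f : Ω → ℂ}
    (hf : Measurable f) {l : ℂ} (hl : ∀ᵐ x ∂μ, f (T x) = l * f x) :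
    ∃ c : ℂ, ∀ᵐ x ∂μ, f x = c := by
  -- For `l = 0` the quotient argument fails, but then `f ∘ T` vanishes almost everywhere, and so
  -- does `f` because `T` preserves `μ`.
  by_cases hl0 : l = 0
  · refine ⟨0, ?_⟩
    have h1 : ∀ᵐ x ∂μ, f (T x) = 0 := by simpa [hl0] using hl
    have hm : MeasurableSet {x | f x = 0} := hf (measurableSet_singleton 0)
    rw [← hT.map_eq, ae_map_iff hT.aemeasurable hm]
    exact h1
  by_cases hf0 : ∀ᵐ x ∂μ, f x = 0
  · exact ⟨0, hf0⟩
  -- The factor `l` cancels in `f y / f x`; with the convention `a / 0 = 0` this holds also where `f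
  -- x = 0`.
  obtain ⟨d, hd⟩ := h.ae_eq_const_of_ae_eq_comp_ae (g := fun p : Ω × Ω => f p.2 / f p.1)
    (by exact ((hf.comp measurable_snd).div (hf.comp measurable_fst)).aestronglyMeasurable) (by
      filter_upwards [Measure.quasiMeasurePreserving_fst.ae hl,
        Measure.quasiMeasurePreserving_snd.ae hl] with p h1 h2
      simp only [Function.comp_apply, Prod.map_fst, Prod.map_snd, h1, h2]
      exact mul_div_mul_left _ _ hl0)
  have hsec := Measure.ae_ae_of_ae_prod hd
  -- Fix one `x` with `f x ≠ 0` for which `f y / f x = d` for almost every `y`.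
  obtain ⟨x, hx0, hx⟩ := ((not_eventually.1 hf0).and_eventually hsec).exists
  refine ⟨d * f x, ?_⟩
  filter_upwards [hx] with y hy
  exact (div_eq_iff hx0).1 hy

end Product

end CapacitySystem

/-! ### The equivalence -/

open CapacitySystem MeasureTheory in
theorem theorem5p5 {Ω : Type u} [MeasurableSpace Ω] (V : Set Ω → ℝ) (T : Ω → Ω)
    (hVT : CapacitySystem.IsCapacityPreserving V T)
    (hV : CapacitySystem.IsUpperProbability V) :
    List.TFAE [
      CapacitySystem.IsWeaklyMixing V T,
      ∀ (Ω' : Type u) [MeasurableSpace Ω'] (V' : Set Ω' → ℝ) (T' : Ω' → Ω'),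
        CapacitySystem.IsCapacityPreserving V' T' →
        CapacitySystem.IsUpperProbability V' →
        CapacitySystem.IsErgodic V' T' →
        CapacitySystem.IsErgodic (CapacitySystem.prod V V') (Prod.map T T'),
      CapacitySystem.IsErgodic (CapacitySystem.prod V V) (Prod.map T T)] := by
  tfae_have 1 → 2 := by
    intro hwm Ω' _ V' T' hVT' hV' herg'
    obtain ⟨Q, hQ, hQT⟩ := hV.exists_ergodic_isControlMeasure hVT
      fun B hB hinv => hwm.zero_or_compl_zero hV.1 hB hinv
    obtain ⟨Q', hQ', hQT'⟩ := hV'.exists_ergodic_isControlMeasure hVT'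
      fun B hB hinv => (herg' B hB hinv).2
    rw [isErgodic_prod_iff hV hV' hQ hQ' hQT.toMeasurePreserving hQT'.toMeasurePreserving]
    refine ergodic_prodMap hQT.toMeasurePreserving hQT' fun f hf ⟨l, hl⟩ => ?_
    obtain ⟨c, hc⟩ := hwm f hf ⟨l, hQ.almostSurely_iff.2 hl⟩
    exact ⟨c, hQ.almostSurely_iff.1 hc⟩
  tfae_have 2 → 3 := by
    intro h
    refine h Ω V T hVT hV ?_
    -- Ergodicity of `V` itself comes from applying the hypothesis to the one-point system and
    -- projecting; only then may `V` serve as the second factor.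
    let δ : ProbabilityMeasure PUnit.{u + 1} := ⟨Measure.dirac PUnit.unit, inferInstance⟩
    have hδ := isUpperProbability_toSetFun δ
    have hpre : ∀ B : Set PUnit.{u + 1}, id ⁻¹' B = B := fun B => rfl
    refine isErgodic_of_prod hV hδ (T' := id) (h PUnit (toSetFun δ) id
      ⟨hδ.1, measurable_id, fun A _ => rfl⟩ hδ fun B _ _ => ?_)
    rcases Set.eq_empty_or_nonempty B with rfl | ⟨⟨⟩, hB⟩
    · exact ⟨Or.inl hδ.1.empty, Or.inl hδ.1.empty⟩
    · obtain rfl : B = Set.univ := Set.eq_univ_of_forall fun ⟨⟩ => hB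
      exact ⟨Or.inr hδ.1.univ, Or.inr (by rw [Set.compl_univ, hδ.1.empty])⟩
  tfae_have 3 → 1 := by
    intro h f hf ⟨l, hl⟩
    have herg := isErgodic_of_prod hV hV h
    obtain ⟨Q, hQ, hQT⟩ := hV.exists_ergodic_isControlMeasure hVT
      fun B hB hinv => (herg B hB hinv).2
    have hprod := (isErgodic_prod_iff hV hV hQ hQ hQT.toMeasurePreserving
      hQT.toMeasurePreserving).1 h
    obtain ⟨c, hc⟩ := ae_eq_const_of_ergodic_prodMap hQT.toMeasurePreserving hprod hf
      (hQ.almostSurely_iff.1 hl)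
    exact ⟨c, hQ.almostSurely_iff.2 hc⟩
  tfae_finish
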